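/- Let $E\subset[0,1]^2$ be a finite set of $n\ge 2$ points, and let $0<s\le 2$ and $A\in\mathbb R$. Call $E$ *$s$-adaptable with energy constant $A$* if $$\frac1{\binom n2}\sum_{\substack{P,Q\in E\\ P\ne Q}}|P-Q|^{-s}\le A\quad\text{(energy)}\qquad\text{and}\qquad \min\{|P-Q|: P,Q\in E,\ P\neq Q\}\ge n^{-1/s}\quad\text{(separation)}.$$ For a $k$-tuple $(\alpha_1,\dots,\alpha_k)$ of nonzero real numbers, a *$k$-chain of type $(\alpha_1,\dots,\alpha_k)$ in $E$* is a tuple $(R_1,\dots,R_{k+1})\in E^{k+1}$ (the points need not be distinct) with $R_j\cdot R_{j+1}=\alpha_j$ for all $j=1,\dots,k$. For every integer $k\ge 1$ and every real $A$ there are constants $C$ and $N$, depending only on $k$ and $A$, such that for every $0<s\le 2$, every $k$-tuple $(\alpha_1,\dots,\alpha_k)$ of nonzero real numbers and every set $E\subset[0,1]^2$ of $n>N$ points that is $s$-adaptable with energy constant $A$, the number of $k$-chains of type $(\alpha_1,\dots,\alpha_k)$ in $E$ is at most $$C\cdot\begin{cases} (\log_2 n)^{\frac{2k-6}{3}}\,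 n^{\frac{4k+12}{9}+\frac{k-3}{3s}} & \text{if } k\equiv 0 \pmod 3,\\ (\log_2 n)^{\frac{2k-2}{3}}\, n^{\frac{4k+8}{9}+\frac{k-1}{3s}} & \text{if } k\equiv 1 \pmod 3,\\ (\log_2 n)^{\frac{2k+2}{3}}\, n^{\frac{4k+4}{9}+\frac{k+1}{3s}} & \text{if } k\equiv 2 \pmod 3. \end{cases}$$ -/

import Mathlib

noncomputable section

/-- The Euclidean plane. -/
abbrev Plane : Type := EuclideanSpace ℝ (Fin 2)

/-- A finite set `E` of `n = E.card` points is `s`-adaptable with energy constant `A`. -/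
structure IsAdaptable (s A : ℝ) (E : Finset Plane) : Prop where
  subset_square : ∀ P ∈ E, ∀ i, P i ∈ Set.Icc (0 : ℝ) 1
  energy : 1 / (E.card.choose 2 : ℝ) * ∑ p ∈ E.offDiag, (dist p.1 p.2) ^ (-s) ≤ A
  separation : ∀ P ∈ E, ∀ Q ∈ E, P ≠ Q → (E.card : ℝ) ^ (-(1 / s)) ≤ dist P Q

/-- The `k`-chains of type `α` in `E`: all tuples `(R 0, …, R k)` of points of `E` (not necessarily
distinct) whose successive dot products are `α 0, …, α (k - 1)`. -/
def chains {k : ℕ} (α : Fin k → ℝ) (E : Finset Plane) : Set (Fin (k + 1) → Plane) :=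
  {R | (∀ i, R i ∈ E) ∧ ∀ j : Fin k, inner ℝ (R j.castSucc) (R j.succ) = α j}

/-- There are finitely many chains, so that their `Set.ncard` is their number. -/
theorem chains_finite {k : ℕ} (α : Fin k → ℝ) (E : Finset Plane) : (chains α E).Finite :=
  (Set.Finite.pi' fun _ : Fin (k + 1) => E.finite_toSet).subset fun _ h => h.1

/-- The bound on the number of `k`-chains in an `s`-adaptable set of `n` points. -/
def chainBound (k : ℕ) (s : ℝ) (n : ℕ) : ℝ :=
  if k % 3 = 0 then
    Real.logb 2 n ^ ((2 * k - 6 : ℝ) / 3) *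
      (n : ℝ) ^ ((4 * k + 12 : ℝ) / 9 + (k - 3 : ℝ) / (3 * s))
  else if k % 3 = 1 then
    Real.logb 2 n ^ ((2 * k - 2 : ℝ) / 3) *
      (n : ℝ) ^ ((4 * k + 8 : ℝ) / 9 + (k - 1 : ℝ) / (3 * s))
  else
    Real.logb 2 n ^ ((2 * k + 2 : ℝ) / 3) *
      (n : ℝ) ^ ((4 * k + 4 : ℝ) / 9 + (k + 1 : ℝ) / (3 * s))

end

/-! Two facts about an `n`-point set suffice. By Szemerédi–Trotter, `O(n^(4/3))` ordered pairs have
a given nonzero dot product. Each point has `O(n^(1/s))` neighbors, because they lie on one line in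
the unit square and are `n^(-1/s)`-separated. Peel a chain from its end: removing one point costs a
degree factor, removing two costs an edge factor, the link to the rest being forgotten. Starting
from a single edge, one point and one edge per three steps give exactly the required power of `n`;
the remaining residues take one more point or one more edge. The logarithmic factors are at least 1.

Szemerédi–Trotter for `r ^ 3` points and lines (`sum_card_through_le_pow_four`) comes from a
cutting. Every `r ^ 2`-th level of the arrangement is kept, with the shift chosen by averaging so
that these levels carry few vertices (`exists_light_shift`). The slabs between them are cut into
`O(r ^ 2)` cells, each met by at most `2 * r ^ 2` lines (`card_lines_meeting_cell_le`), and
Cauchy–Schwarz is applied in each cell (`sum_card_through_le`). -/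

namespace Incidence

open Finset Filter Topology

noncomputable section

/-! ### Lines and their ranks -/

/-- The value at `x` of the line `y = l.1 * x + l.2`. -/
def lineEval (l : ℝ × ℝ) (x : ℝ) : ℝ := l.1 * x + l.2

open Classical in
/-- The lines of `L` through the point `p`. -/
def through (L : Finset (ℝ × ℝ)) (p : ℝ × ℝ) : Finset (ℝ × ℝ) :=
  L.filter fun l => lineEval l p.1 = p.2

open Classical in
/-- The number of lines of `L` strictly below `p`. -/
def below (L : Finset (ℝ × ℝ)) (p : ℝ × ℝ) : ℕ := #(L.filter fun l => lineEval l p.1 < p.2)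

open Classical in
/-- The number of lines of `L` through or below `p`. -/
def atMost (L : Finset (ℝ × ℝ)) (p : ℝ × ℝ) : ℕ := #(L.filter fun l => lineEval l p.1 ≤ p.2)

theorem mem_through {L : Finset (ℝ × ℝ)} {p l : ℝ × ℝ} :
    l ∈ through L p ↔ l ∈ L ∧ lineEval l p.1 = p.2 := by
  classical
  simp [through]

theorem atMost_eq (L : Finset (ℝ × ℝ)) (p : ℝ × ℝ) :
    atMost L p = below L p + #(through L p) := by
  classical
  unfold atMost below through
  rw [← card_union_of_disjoint]
  · congr 1
    ext l
    simp only [mem_filter, mem_union, le_iff_lt_or_eq]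
    tauto
  · rw [disjoint_filter]
    intro l _ h1 h2
    exact h1.ne h2

theorem below_le_atMost (L : Finset (ℝ × ℝ)) (p : ℝ × ℝ) : below L p ≤ atMost L p := by
  rw [atMost_eq]; omega

theorem continuous_lineEval (l : ℝ × ℝ) : Continuous (lineEval l) := by
  unfold lineEval; fun_prop

/-- Two distinct lines meet at most once. -/
theorem line_eq_of_two_points {l m : ℝ × ℝ} {x y : ℝ} (hxy : x ≠ y)
    (hx : lineEval l x = lineEval m x) (hy : lineEval l y = lineEval m y) : l = m := by
  unfold lineEval at hx hy
  have h : (l.1 - m.1) * (x - y) = 0 := by linarith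
  have h1 : l.1 = m.1 := by
    rcases mul_eq_zero.1 h with h | h
    · linarith
    · exact absurd (by linarith) hxy
  refine Prod.ext h1 ?_
  rw [h1] at hx
  linarith

/-- Strict inequalities between continuous functions are open conditions, and `L` is finite. -/
theorem eventually_order (L : Finset (ℝ × ℝ)) (l : ℝ × ℝ) (x₀ : ℝ) :
    ∀ᶠ x in 𝓝 x₀, ∀ m ∈ L, (lineEval m x₀ < lineEval l x₀ → lineEval m x < lineEval l x) ∧
      (lineEval l x₀ < lineEval m x₀ → lineEval l x < lineEval m x) := by
  rw [eventually_all_finset]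
  intro m _
  have hl := (continuous_lineEval l).continuousAt (x := x₀)
  have hm := (continuous_lineEval m).continuousAt (x := x₀)
  refine Filter.Eventually.and ?_ ?_
  · by_cases h : lineEval m x₀ < lineEval l x₀
    · filter_upwards [hm.eventually_lt hl h] with x hx _ using hx
    · exact Eventually.of_forall fun _ h' => absurd h' h
  · by_cases h : lineEval l x₀ < lineEval m x₀
    · filter_upwards [hl.eventually_lt hm h] with x hx _ using hx
    · exact Eventually.of_forall fun _ h' => absurd h' h

/-- Along a line, the rank interval at a point contains the rank intervals at nearby points. -/
theorem eventually_rank_subset (L : Finset (ℝ × ℝ)) (l : ℝ × ℝ) (x₀ : ℝ) :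
    ∀ᶠ x in 𝓝 x₀, below L (x₀, lineEval l x₀) ≤ below L (x, lineEval l x) ∧
      atMost L (x, lineEval l x) ≤ atMost L (x₀, lineEval l x₀) := by
  classical
  filter_upwards [eventually_order L l x₀] with x hx
  constructor
  · refine card_le_card fun m hm => ?_
    rw [mem_filter] at hm ⊢
    exact ⟨hm.1, (hx m hm.1).1 hm.2⟩
  · refine card_le_card fun m hm => ?_
    rw [mem_filter] at hm ⊢
    refine ⟨hm.1, ?_⟩
    by_contra h
    exact absurd ((hx m hm.1).2 (not_le.1 h)) (not_lt.2 hm.2)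

/-- Along a line, the rank interval is locally constant away from the vertices. -/
theorem eventually_rank_eq {L : Finset (ℝ × ℝ)} {l : ℝ × ℝ} (hl : l ∈ L) {x₀ : ℝ}
    (h : #(through L (x₀, lineEval l x₀)) < 2) :
    ∀ᶠ x in 𝓝 x₀, below L (x, lineEval l x) = below L (x₀, lineEval l x₀) ∧
      atMost L (x, lineEval l x) = atMost L (x₀, lineEval l x₀) := by
  classical
  have huniq : ∀ m ∈ L, lineEval m x₀ = lineEval l x₀ → m = l := by
    intro m hm hml
    by_contra hne
    have : 1 < #(through L (x₀, lineEval l x₀)) :=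
      one_lt_card.2 ⟨m, mem_through.2 ⟨hm, hml⟩, l, mem_through.2 ⟨hl, rfl⟩, hne⟩
    omega
  filter_upwards [eventually_order L l x₀] with x hx
  constructor
  · unfold below
    congr 1
    ext m
    simp only [mem_filter, and_congr_right_iff]
    intro hm
    refine ⟨fun h' => ?_, (hx m hm).1⟩
    rcases lt_trichotomy (lineEval m x₀) (lineEval l x₀) with h1 | h1 | h1
    · exact h1
    · rw [huniq m hm h1] at h'; exact absurd h' (lt_irrefl _)
    · exact absurd ((hx m hm).2 h1) (not_lt.2 h'.le)
  · unfold atMost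
    congr 1
    ext m
    simp only [mem_filter, and_congr_right_iff]
    intro hm
    rcases lt_trichotomy (lineEval m x₀) (lineEval l x₀) with h1 | h1 | h1
    · exact ⟨fun _ => h1.le, fun _ => ((hx m hm).1 h1).le⟩
    · simp only [huniq m hm h1, le_refl]
    · exact ⟨fun h' => absurd ((hx m hm).2 h1) (not_lt.2 h'), fun h' => absurd h1 (not_lt.2 h')⟩

/-! ### Slabs between equally spaced levels -/

/-- The levels `≡ -c - 1` modulo `q` cut the plane into slabs; `loSlab` is the lowest slab whose
closure contains `p`. -/
def loSlab (L : Finset (ℝ × ℝ)) (q c : ℕ) (p : ℝ × ℝ) : ℕ := (below L p + c) / q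

/-- The highest slab whose closure contains `p`. -/
def hiSlab (L : Finset (ℝ × ℝ)) (q c : ℕ) (p : ℝ × ℝ) : ℕ := (atMost L p + c) / q

theorem loSlab_le_hiSlab (L : Finset (ℝ × ℝ)) (q c : ℕ) (p : ℝ × ℝ) :
    loSlab L q c p ≤ hiSlab L q c p :=
  Nat.div_le_div_right (Nat.add_le_add_right (below_le_atMost L p) c)

/-- A line that leaves the interior of a slab passes through a vertex on its boundary. -/
theorem exists_vertex_of_leaves_slab {L : Finset (ℝ × ℝ)} {q c j : ℕ} {l : ℝ × ℝ} (hl : l ∈ L)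
    {x y : ℝ} (hxy : x ≤ y) (hlo : loSlab L q c (x, lineEval l x) = j)
    (hhi : hiSlab L q c (x, lineEval l x) = j)
    (hy : ¬ (loSlab L q c (y, lineEval l y) = j ∧ hiSlab L q c (y, lineEval l y) = j)) :
    ∃ z ∈ Set.Ioc x y, 2 ≤ #(through L (z, lineEval l z)) ∧
      loSlab L q c (z, lineEval l z) < hiSlab L q c (z, lineEval l z) ∧
      loSlab L q c (z, lineEval l z) ≤ j ∧ j ≤ hiSlab L q c (z, lineEval l z) := by
  by_contra! hcon
  set s : Set ℝ := {z | loSlab L q c (z, lineEval l z) = j ∧ hiSlab L q c (z, lineEval l z) = j}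
    with hs
  -- Continuous induction on `[x, y]`. A limit of good abscissas is either an ordinary point, where
  -- ranks are locally constant, or a vertex, which `hcon` keeps off the boundary of slab `j`.
  have hclosed : IsClosed (s ∩ Set.Icc x y) := by
    refine isClosed_of_closure_subset fun z hz => ?_
    have hzI : z ∈ Set.Icc x y :=
      closure_minimal Set.inter_subset_right isClosed_Icc hz
    refine ⟨?_, hzI⟩
    rcases hzI.1.eq_or_lt with rfl | hxz
    · exact ⟨hlo, hhi⟩
    rw [mem_closure_iff_frequently] at hz
    by_cases h2 : #(through L (z, lineEval l z)) < 2
    · obtain ⟨w, hw, hw1, hw2⟩ := (hz.and_eventually (eventually_rank_eq hl h2)).exists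
      have := hw.1
      simp only [hs, Set.mem_ofPred_eq, loSlab, hiSlab, hw1, hw2] at this ⊢
      exact this
    · obtain ⟨w, hw, hw1, hw2⟩ := (hz.and_eventually (eventually_rank_subset L l z)).exists
      have h3 : loSlab L q c (z, lineEval l z) ≤ j := by
        rw [← hw.1.1]
        exact Nat.div_le_div_right (Nat.add_le_add_right hw1 c)
      have h4 : j ≤ hiSlab L q c (z, lineEval l z) := by
        rw [← hw.1.2]
        exact Nat.div_le_div_right (Nat.add_le_add_right hw2 c)
      have h5 := hcon z ⟨hxz, hzI.2⟩ (not_lt.1 h2)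
      by_cases h6 : loSlab L q c (z, lineEval l z) < hiSlab L q c (z, lineEval l z)
      · have := h5 h6 h3
        omega
      · exact ⟨by omega, by omega⟩
  -- Openness: near `z` the rank interval can only shrink, so it stays within slab `j`.
  have hsub : Set.Icc x y ⊆ s := by
    refine hclosed.Icc_subset_of_forall_mem_nhdsWithin ⟨hlo, hhi⟩ ?_
    rintro z ⟨hz, -⟩
    refine mem_nhdsWithin_of_mem_nhds ?_
    filter_upwards [eventually_rank_subset L l z] with w hw
    have h1 : loSlab L q c (z, lineEval l z) ≤ loSlab L q c (w, lineEval l w) :=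
      Nat.div_le_div_right (Nat.add_le_add_right hw.1 c)
    have h2 : hiSlab L q c (w, lineEval l w) ≤ hiSlab L q c (z, lineEval l z) :=
      Nat.div_le_div_right (Nat.add_le_add_right hw.2 c)
    have h3 := loSlab_le_hiSlab L q c (w, lineEval l w)
    rw [hz.1] at h1
    rw [hz.2] at h2
    exact ⟨by omega, by omega⟩
  exact hy (hsub ⟨hxy, le_rfl⟩)

open Classical in
/-- At each abscissa, at most `q` lines are in the interior of a given slab. -/
theorem card_lines_in_slab_le (L : Finset (ℝ × ℝ)) {q : ℕ} (hq : 0 < q) (c j : ℕ) (x : ℝ) :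
    #(L.filter fun l => loSlab L q c (x, lineEval l x) = j ∧
      hiSlab L q c (x, lineEval l x) = j) ≤ q := by
  set S := L.filter fun l => loSlab L q c (x, lineEval l x) = j ∧
    hiSlab L q c (x, lineEval l x) = j with hS
  rcases S.eq_empty_or_nonempty with h | h
  · simp [h]
  obtain ⟨t, ht, htmax⟩ := exists_max_image S (fun l => lineEval l x) h
  obtain ⟨b, hb, hbmin⟩ := exists_min_image S (fun l => lineEval l x) h
  -- The lines of `S` number at most the rank through `t` minus the rank below `b`, and both ranks,
  -- shifted by `c`, lie in one block of `q` consecutive integers.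
  have hsub : S ⊆ (L.filter fun l => lineEval l x ≤ lineEval t x) \
      (L.filter fun l => lineEval l x < lineEval b x) := by
    intro l hl
    rw [Finset.mem_sdiff, mem_filter, mem_filter]
    exact ⟨⟨(mem_filter.1 hl).1, htmax l hl⟩, fun h' => absurd h'.2 (not_lt.2 (hbmin l hl))⟩
  have hsub' : (L.filter fun l => lineEval l x < lineEval b x) ⊆
      (L.filter fun l => lineEval l x ≤ lineEval t x) := by
    intro l hl
    rw [mem_filter] at hl ⊢
    exact ⟨hl.1, hl.2.le.trans (htmax b hb)⟩
  have h1 := card_le_card hsub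
  rw [card_sdiff_of_subset hsub'] at h1
  have h2 : (atMost L (x, lineEval t x) + c) / q = j := (mem_filter.1 ht).2.2
  have h3 : (below L (x, lineEval b x) + c) / q = j := (mem_filter.1 hb).2.1
  rw [Nat.div_eq_iff hq] at h2 h3
  unfold atMost at h2
  unfold below at h3
  simp only at h2 h3
  omega

/-- Passing from `b` to `b + 1` replaces the term `b / q` by `(b + q) / q`, which is larger by 1. -/
theorem sum_range_add_div (b q : ℕ) (hq : 0 < q) : ∑ c ∈ range q, (b + c) / q = b := by
  induction b with
  | zero =>
    refine sum_eq_zero fun c hc => ?_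
    rw [zero_add]
    exact Nat.div_eq_of_lt (mem_range.1 hc)
  | succ b ih =>
    have h1 := sum_range_succ (fun c => (b + c) / q) q
    have h2 := sum_range_succ' (fun c => (b + c) / q) q
    have h3 : (b + q) / q = b / q + 1 := Nat.add_div_right b hq
    have h4 : ∑ c ∈ range q, (b + 1 + c) / q = ∑ c ∈ range q, (b + (c + 1)) / q :=
      sum_congr rfl fun c _ => by congr 1; omega
    simp only [add_zero] at h1 h2
    omega

/-- The difference counts the kept levels through `p`. As many levels as lines pass through `p`, and
each level is kept for exactly one shift. -/
theorem sum_range_hiSlab_sub_loSlab (L : Finset (ℝ × ℝ)) {q : ℕ} (hq : 0 < q) (p : ℝ × ℝ) :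
    ∑ c ∈ range q, (hiSlab L q c p - loSlab L q c p) = #(through L p) := by
  rw [sum_tsub_distrib]
  · unfold hiSlab loSlab
    rw [sum_range_add_div _ _ hq, sum_range_add_div _ _ hq, atMost_eq]
    omega
  · exact fun c _ => loSlab_le_hiSlab L q c p

/-! ### Vertices and the choice of levels -/

open Classical in
/-- The points that lie on at least two lines of `L`. -/
def vertices (L : Finset (ℝ × ℝ)) : Finset (ℝ × ℝ) :=
  ((L ×ˢ L).image fun d => ((d.2.2 - d.1.2) / (d.1.1 - d.2.1),
    lineEval d.1 ((d.2.2 - d.1.2) / (d.1.1 - d.2.1)))).filter fun p => 2 ≤ #(through L p)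

theorem mem_vertices {L : Finset (ℝ × ℝ)} {p : ℝ × ℝ} :
    p ∈ vertices L ↔ 2 ≤ #(through L p) := by
  classical
  unfold vertices
  rw [mem_filter, and_iff_right_iff_imp]
  intro h
  obtain ⟨l, hl, m, hm, hne⟩ := one_lt_card.1 (show 1 < #(through L p) from h)
  rw [mem_through] at hl hm
  rw [mem_image]
  refine ⟨(l, m), mem_product.2 ⟨hl.1, hm.1⟩, ?_⟩
  have h1 : l.1 - m.1 ≠ 0 := by
    intro h0
    refine hne (line_eq_of_two_points (x := p.1) (y := p.1 + 1) (by simp) (hl.2.trans hm.2.symm) ?_)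
    have h2 := hl.2.trans hm.2.symm
    unfold lineEval at h2 ⊢
    linarith
  have hx : (m.2 - l.2) / (l.1 - m.1) = p.1 := by
    rw [div_eq_iff h1]
    have h2 := hl.2.trans hm.2.symm
    unfold lineEval at h2
    linarith
  simp only [hx]
  exact Prod.ext rfl hl.2

/-- Two distinct lines share at most one vertex, so the sum of `t * (t - 1)` is at most `#L ^ 2`;
and `t ^ 2 ≤ 2 * t * (t - 1)` for `t ≥ 2`. -/
theorem sum_vertices_sq_le (L : Finset (ℝ × ℝ)) :
    ∑ p ∈ vertices L, #(through L p) ^ 2 ≤ 2 * #L ^ 2 := by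
  classical
  have h1 : ∑ p ∈ vertices L, #(through L p).offDiag ≤ #L ^ 2 := by
    have hb : ∀ p ∈ vertices L, #(through L p).offDiag =
        #(L.offDiag.bipartiteAbove (fun p (d : (ℝ × ℝ) × (ℝ × ℝ)) =>
          lineEval d.1 p.1 = p.2 ∧ lineEval d.2 p.1 = p.2) p) := by
      intro p _
      congr 1
      ext d
      simp only [mem_offDiag, mem_through, bipartiteAbove, mem_filter]
      tauto
    rw [sum_congr rfl hb, sum_card_bipartiteAbove_eq_sum_card_bipartiteBelow]
    calc _ ≤ ∑ _d ∈ L.offDiag, 1 := by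
          refine sum_le_sum fun d hd => card_le_one.2 fun p hp p' hp' => ?_
          simp only [bipartiteBelow, mem_filter] at hp hp'
          rw [mem_offDiag] at hd
          have hx : p.1 = p'.1 := by
            by_contra hne
            exact hd.2.2 (line_eq_of_two_points hne (hp.2.1.trans hp.2.2.symm)
              (hp'.2.1.trans hp'.2.2.symm))
          refine Prod.ext hx ?_
          rw [← hp.2.1, ← hp'.2.1, hx]
      _ ≤ #L ^ 2 := by
          rw [sum_const, smul_eq_mul, mul_one, offDiag_card, sq]
          exact Nat.sub_le _ _
  calc ∑ p ∈ vertices L, #(through L p) ^ 2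
      ≤ ∑ p ∈ vertices L, 2 * #(through L p).offDiag := by
        refine sum_le_sum fun p hp => ?_
        have h2 := mem_vertices.1 hp
        rw [offDiag_card]
        obtain ⟨t, ht⟩ := Nat.exists_eq_add_of_le h2
        rw [ht]
        have : (2 + t) * (2 + t) - (2 + t) = (2 + t) * (1 + t) := by
          rw [Nat.sub_eq_iff_eq_add (Nat.le_mul_self _)]; ring
        rw [this]
        nlinarith
    _ ≤ 2 * #L ^ 2 := by
        rw [← mul_sum]
        exact Nat.mul_le_mul_left 2 h1

/-- Some choice of equally spaced levels passes through few vertices, counted with multiplicity. -/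
theorem exists_light_shift (L : Finset (ℝ × ℝ)) {q : ℕ} (hq : 0 < q) :
    ∃ c < q, q * ∑ p ∈ vertices L, #(through L p) * (hiSlab L q c p - loSlab L q c p) ≤
      2 * #L ^ 2 := by
  by_contra! hcon
  have h1 : ∑ c ∈ range q, 2 * #L ^ 2 < ∑ c ∈ range q,
      q * ∑ p ∈ vertices L, #(through L p) * (hiSlab L q c p - loSlab L q c p) :=
    sum_lt_sum_of_nonempty ⟨0, mem_range.2 hq⟩ fun c hc => hcon c (mem_range.1 hc)
  -- Summed over all shifts, the weights become the sum of squares in `sum_vertices_sq_le`.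
  rw [sum_const, card_range, smul_eq_mul, ← mul_sum, sum_comm] at h1
  simp_rw [← mul_sum, sum_range_hiSlab_sub_loSlab L hq, ← sq] at h1
  exact absurd (Nat.mul_le_mul_left q (sum_vertices_sq_le L)) (not_le.2 h1)

/-! ### Cells of a slab -/

open Classical in
/-- The vertices on the boundary of the slab `j`. -/
def boundaryVertices (L : Finset (ℝ × ℝ)) (q c j : ℕ) : Finset (ℝ × ℝ) :=
  (vertices L).filter fun p => loSlab L q c p < hiSlab L q c p ∧ loSlab L q c p ≤ j ∧
    j ≤ hiSlab L q c p

open Classical in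
/-- The number of incidences at vertices on the boundary of the slab `j` with abscissa at
most `x`. -/
def boundaryWeight (L : Finset (ℝ × ℝ)) (q c j : ℕ) (x : ℝ) : ℕ :=
  ∑ p ∈ (boundaryVertices L q c j).filter fun p => p.1 ≤ x, #(through L p)

theorem boundaryWeight_le (L : Finset (ℝ × ℝ)) (q c j : ℕ) (x : ℝ) :
    boundaryWeight L q c j x ≤ ∑ p ∈ boundaryVertices L q c j, #(through L p) :=
  sum_le_sum_of_subset (filter_subset _ _)

/-- A vertex on kept levels borders `hi - lo + 1 ≤ 2 * (hi - lo)` slabs. -/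
theorem sum_boundaryVertices_le (L : Finset (ℝ × ℝ)) (q c J : ℕ) :
    ∑ j ∈ range J, ∑ p ∈ boundaryVertices L q c j, #(through L p) ≤
      2 * ∑ p ∈ vertices L, #(through L p) * (hiSlab L q c p - loSlab L q c p) := by
  classical
  simp only [boundaryVertices, sum_filter]
  rw [sum_comm, mul_sum]
  refine sum_le_sum fun p _ => ?_
  rw [← sum_filter, sum_const, smul_eq_mul]
  by_cases h : loSlab L q c p < hiSlab L q c p
  · have h1 : #((range J).filter fun j => loSlab L q c p < hiSlab L q c p ∧ loSlab L q c p ≤ j ∧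
        j ≤ hiSlab L q c p) ≤ hiSlab L q c p + 1 - loSlab L q c p := by
      rw [← Nat.card_Icc]
      refine card_le_card fun j hj => ?_
      rw [mem_filter] at hj
      exact mem_Icc.2 hj.2.2
    calc _ ≤ (2 * (hiSlab L q c p - loSlab L q c p)) * #(through L p) :=
          Nat.mul_le_mul_right _ (by omega)
      _ = _ := by ring
  · simp [h]

open Classical in
/-- The points of a slab between whose abscissas the boundary weight increases by less than `q`
meet at most `2 * q` lines. -/
theorem card_lines_meeting_cell_le (L : Finset (ℝ × ℝ)) {q : ℕ} (hq : 0 < q) (c j i : ℕ)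
    (Q : Finset (ℝ × ℝ)) (hlo : ∀ p ∈ Q, loSlab L q c p = j) (hhi : ∀ p ∈ Q, hiSlab L q c p = j)
    (hi : ∀ p ∈ Q, boundaryWeight L q c j p.1 / q = i) :
    #(Q.biUnion (through L)) ≤ 2 * q := by
  rcases Q.eq_empty_or_nonempty with h | h
  · simp [h]
  obtain ⟨t, ht, htmax⟩ := exists_max_image Q (fun p => p.1) h
  obtain ⟨b, hb, hbmin⟩ := exists_min_image Q (fun p => p.1) h
  set V := (boundaryVertices L q c j).filter fun p => p.1 ≤ t.1 with hV
  set U := (boundaryVertices L q c j).filter fun p => p.1 ≤ b.1 with hU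
  have hUV : U ⊆ V := by
    intro p hp
    rw [mem_filter] at hp ⊢
    exact ⟨hp.1, hp.2.trans (htmax b hb)⟩
  -- A line meeting `Q` is either still inside the slab at the rightmost abscissa, or has left
  -- through a boundary vertex in between; the weight increase counts the latter.
  have hsub : Q.biUnion (through L) ⊆
      (L.filter fun l => loSlab L q c (t.1, lineEval l t.1) = j ∧
        hiSlab L q c (t.1, lineEval l t.1) = j) ∪ (V \ U).biUnion (through L) := by
    intro l hl
    obtain ⟨p, hp, hlp⟩ := mem_biUnion.1 hl
    obtain ⟨hlL, hpe⟩ := mem_through.1 hlp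
    have hpp : (p.1, lineEval l p.1) = p := Prod.ext rfl hpe
    rw [mem_union]
    by_cases hlt : loSlab L q c (t.1, lineEval l t.1) = j ∧ hiSlab L q c (t.1, lineEval l t.1) = j
    · exact Or.inl (mem_filter.2 ⟨hlL, hlt⟩)
    · right
      obtain ⟨z, hz, h2, h3, h4, h5⟩ := exists_vertex_of_leaves_slab hlL (htmax p hp)
        (by rw [hpp]; exact hlo p hp) (by rw [hpp]; exact hhi p hp) hlt
      rw [mem_biUnion]
      refine ⟨(z, lineEval l z), ?_, mem_through.2 ⟨hlL, rfl⟩⟩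
      rw [Finset.mem_sdiff, mem_filter, mem_filter]
      refine ⟨⟨mem_filter.2 ⟨mem_vertices.2 h2, h3, h4, h5⟩, hz.2⟩, fun h' => ?_⟩
      exact absurd ((hbmin p hp).trans_lt hz.1) (not_lt.2 h'.2)
  have hsum : ∑ p ∈ V \ U, #(through L p) + boundaryWeight L q c j b.1 =
      boundaryWeight L q c j t.1 := sum_sdiff hUV
  have h1 := hi t ht
  have h2 := hi b hb
  rw [Nat.div_eq_iff hq] at h1 h2
  calc _ ≤ _ := card_le_card hsub
    _ ≤ _ := card_union_le _ _
    _ ≤ q + ∑ p ∈ V \ U, #(through L p) :=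
        add_le_add (card_lines_in_slab_le L hq c j t.1) card_biUnion_le
    _ ≤ 2 * q := by omega

/-! ### Szemerédi–Trotter -/

/-- The incidence bound that follows from the Cauchy–Schwarz inequality. -/
theorem sum_card_through_le (Q M : Finset (ℝ × ℝ)) (r : ℕ) (hM : #M ≤ 2 * r ^ 2) :
    ∑ p ∈ Q, #(through M p) ≤ 2 * r * #Q + 2 * r ^ 2 := by
  classical
  set I := ∑ p ∈ Q, #(through M p) with hI
  have hI' : I = ∑ l ∈ M, #(Q.filter fun p => lineEval l p.1 = p.2) :=
    sum_card_bipartiteAbove_eq_sum_card_bipartiteBelow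
      (fun (p l : ℝ × ℝ) => lineEval l p.1 = p.2)
  have h1 : I ^ 2 ≤ #M * ∑ l ∈ M, #(Q.filter fun p => lineEval l p.1 = p.2) ^ 2 := by
    rw [hI']; exact sq_sum_le_card_mul_sum_sq
  have h2 : ∑ l ∈ M, #(Q.filter fun p => lineEval l p.1 = p.2).offDiag ≤ #Q ^ 2 := by
    have hb : ∀ l ∈ M, #(Q.filter fun p => lineEval l p.1 = p.2).offDiag =
        #(Q.offDiag.bipartiteAbove (fun l (d : (ℝ × ℝ) × (ℝ × ℝ)) =>
          lineEval l d.1.1 = d.1.2 ∧ lineEval l d.2.1 = d.2.2) l) := by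
      intro p _
      congr 1
      ext d
      simp only [mem_offDiag, bipartiteAbove, mem_filter]
      tauto
    rw [sum_congr rfl hb, sum_card_bipartiteAbove_eq_sum_card_bipartiteBelow]
    calc _ ≤ ∑ _d ∈ Q.offDiag, 1 := by
          refine sum_le_sum fun d hd => card_le_one.2 fun l hl m hm => ?_
          simp only [bipartiteBelow, mem_filter] at hl hm
          rw [mem_offDiag] at hd
          have hx : d.1.1 ≠ d.2.1 := by
            intro hx
            refine hd.2.2 (Prod.ext hx ?_)
            rw [← hl.2.1, ← hl.2.2, hx]
          exact line_eq_of_two_points hx (hl.2.1.trans hm.2.1.symm) (hl.2.2.trans hm.2.2.symm)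
      _ ≤ #Q ^ 2 := by
          rw [sum_const, smul_eq_mul, mul_one, offDiag_card, sq]
          exact Nat.sub_le _ _
  have h3 : ∑ l ∈ M, #(Q.filter fun p => lineEval l p.1 = p.2) ^ 2 ≤ #Q ^ 2 + I := by
    rw [hI']
    refine le_trans ?_ (Nat.add_le_add_right h2 _)
    rw [← sum_add_distrib]
    refine sum_le_sum fun l _ => ?_
    rw [offDiag_card, sq]
    omega
  -- If `I > 2 * r * #Q + 2 * r ^ 2`, multiplying by `I` and then using `2 * r * #Q * I ≥ 4 * r ^ 2
  -- * #Q ^ 2` contradicts this.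
  have h4 : I ^ 2 ≤ 2 * r ^ 2 * (#Q ^ 2 + I) := h1.trans (Nat.mul_le_mul hM h3)
  by_contra! hlt
  have h5 := Nat.mul_lt_mul_of_pos_left hlt (lt_of_le_of_lt (Nat.zero_le _) hlt)
  have h6 := Nat.mul_le_mul_left (2 * r * #Q) hlt.le
  nlinarith [Nat.zero_le (r ^ 2 * #Q ^ 2), Nat.zero_le (r ^ 3 * #Q)]

/-- The **Szemerédi–Trotter theorem** for `r ^ 3` points and `r ^ 3` non-vertical lines. -/
theorem sum_card_through_le_pow_four (P L : Finset (ℝ × ℝ)) (r : ℕ) (hr : 0 < r)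
    (hP : #P ≤ r ^ 3) (hL : #L ≤ r ^ 3) : ∑ p ∈ P, #(through L p) ≤ 23 * r ^ 4 := by
  classical
  have hq : 0 < r ^ 2 := by positivity
  obtain ⟨c, hc, hlight⟩ := exists_light_shift L hq
  set q := r ^ 2 with hqr
  set S := ∑ p ∈ vertices L, #(through L p) * (hiSlab L q c p - loSlab L q c p) with hS
  have hS4 : S ≤ 2 * r ^ 4 := by
    have h1 : q * S ≤ q * (2 * r ^ 4) := by
      calc q * S ≤ 2 * #L ^ 2 := hlight
        _ ≤ 2 * (r ^ 3) ^ 2 := by gcongr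
        _ = q * (2 * r ^ 4) := by rw [hqr]; ring
    exact Nat.le_of_mul_le_mul_left h1 hq
  set P₁ := P.filter fun p => loSlab L q c p < hiSlab L q c p with hP₁
  set P₂ := P.filter fun p => ¬ loSlab L q c p < hiSlab L q c p with hP₂
  have hsplit : ∑ p ∈ P, #(through L p) = ∑ p ∈ P₁, #(through L p) + ∑ p ∈ P₂, #(through L p) :=
    (sum_filter_add_sum_filter_not _ _ _).symm
  -- Points on kept levels: a non-vertex has at most one incidence, and a vertex is paid for by `S`,
  -- since `hi - lo ≥ 1`.
  have hcut : ∑ p ∈ P₁, #(through L p) ≤ #P + S := by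
    rw [← sum_filter_add_sum_filter_not P₁ (fun p => p ∈ vertices L), add_comm]
    refine add_le_add ?_ ?_
    · calc _ ≤ ∑ p ∈ P₁.filter (fun p => p ∉ vertices L), 1 := by
            refine sum_le_sum fun p hp => ?_
            have := (mem_filter.1 hp).2
            rw [mem_vertices] at this
            omega
        _ = #(P₁.filter (fun p => p ∉ vertices L)) := by simp
        _ ≤ #P := card_le_card ((filter_subset _ _).trans (filter_subset _ _))
    · calc _ ≤ ∑ p ∈ P₁.filter (fun p => p ∈ vertices L),
              #(through L p) * (hiSlab L q c p - loSlab L q c p) := by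
            refine sum_le_sum fun p hp => ?_
            have h1 := (mem_filter.1 (mem_filter.1 hp).1).2
            exact Nat.le_mul_of_pos_right _ (by omega)
        _ ≤ S := sum_le_sum_of_subset fun p hp => (mem_filter.1 hp).2
  set J := r + 2 with hJ
  set cells : Finset (Σ _ : ℕ, ℕ) := (range J).sigma fun j =>
    range ((∑ p ∈ boundaryVertices L q c j, #(through L p)) / q + 1) with hcells
  -- A cell is a slab together with the number of full multiples of `q` that the boundary weight has
  -- reached.
  let cell : ℝ × ℝ → Σ _ : ℕ, ℕ := fun p =>
    ⟨loSlab L q c p, boundaryWeight L q c (loSlab L q c p) p.1 / q⟩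
  have hmaps : ∀ p ∈ P₂, cell p ∈ cells := by
    intro p _
    rw [hcells, mem_sigma, mem_range, mem_range]
    refine ⟨?_, Nat.lt_succ_of_le (Nat.div_le_div_right (boundaryWeight_le L q c _ _))⟩
    have h1 : below L p ≤ r ^ 3 := (card_filter_le _ _).trans hL
    change (below L p + c) / q < r + 2
    rw [Nat.div_lt_iff_lt_mul hq]
    calc below L p + c < r ^ 3 + q := by omega
      _ ≤ (r + 2) * q := by rw [hqr]; nlinarith
  have hcell : ∀ τ ∈ cells, ∑ p ∈ P₂.filter (fun p => cell p = τ), #(through L p) ≤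
      2 * r * #(P₂.filter (fun p => cell p = τ)) + 2 * r ^ 2 := by
    intro τ _
    set Q := P₂.filter (fun p => cell p = τ) with hQ
    have hlo : ∀ p ∈ Q, loSlab L q c p = τ.1 := by
      intro p hp
      rw [← (mem_filter.1 hp).2]
    have hhi : ∀ p ∈ Q, hiSlab L q c p = τ.1 := by
      intro p hp
      have h1 := (mem_filter.1 (mem_filter.1 hp).1).2
      have h2 := loSlab_le_hiSlab L q c p
      have h3 := hlo p hp
      omega
    have hi : ∀ p ∈ Q, boundaryWeight L q c τ.1 p.1 / q = τ.2 := by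
      intro p hp
      rw [← (mem_filter.1 hp).2]
    have hM := card_lines_meeting_cell_le L hq c τ.1 τ.2 Q hlo hhi hi
    refine le_trans (sum_le_sum fun p hp => card_le_card ?_) (sum_card_through_le Q _ r hM)
    intro l hl
    exact mem_through.2 ⟨mem_biUnion.2 ⟨p, hp, hl⟩, (mem_through.1 hl).2⟩
  -- Each slab has at most its total weight over `q`, plus one, cells.
  have hcount : q * #cells ≤ 2 * S + q * J := by
    rw [hcells, card_sigma, mul_sum]
    calc _ ≤ ∑ j ∈ range J, (∑ p ∈ boundaryVertices L q c j, #(through L p) + q) := by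
          refine sum_le_sum fun j _ => ?_
          rw [card_range, mul_add, mul_one]
          exact Nat.add_le_add_right (Nat.mul_div_le _ _) _
      _ ≤ 2 * S + q * J := by
          rw [sum_add_distrib, sum_const, card_range, smul_eq_mul, mul_comm J q]
          exact Nat.add_le_add_right (sum_boundaryVertices_le L q c J) _
  have hinner : ∑ p ∈ P₂, #(through L p) ≤ 2 * r * #P + 2 * (q * #cells) := by
    rw [← sum_fiberwise_of_maps_to hmaps]
    calc _ ≤ ∑ τ ∈ cells, (2 * r * #(P₂.filter (fun p => cell p = τ)) + 2 * r ^ 2) :=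
          sum_le_sum hcell
      _ = 2 * r * #P₂ + 2 * (q * #cells) := by
          rw [sum_add_distrib, ← mul_sum, ← card_eq_sum_card_fiberwise hmaps, sum_const,
            smul_eq_mul, hqr]
          ring
      _ ≤ _ := by
          have : #P₂ ≤ #P := card_filter_le _ _
          gcongr
  have h3 : r ^ 3 ≤ r ^ 4 := Nat.pow_le_pow_right hr (by norm_num)
  have h2 : r ^ 2 ≤ r ^ 4 := Nat.pow_le_pow_right hr (by norm_num)
  have h4 : 2 * r * #P ≤ 2 * r ^ 4 := by
    calc 2 * r * #P ≤ 2 * r * r ^ 3 := by gcongr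
      _ = _ := by ring
  have h5 : q * J = r ^ 3 + 2 * r ^ 2 := by rw [hqr, hJ]; ring
  omega

end

end Incidence

/-! ### Peeling points off a chain -/

open Finset in
/-- The map sending a chain to the chain without its last point has fibers that embed into sets of
neighbors. -/
theorem ncard_chains_succ_le {k : ℕ} (α : Fin (k + 1) → ℝ) (E : Finset Plane) (d : ℕ)
    (hd : ∀ P ∈ E, ∀ j, {Q | Q ∈ E ∧ inner ℝ P Q = α j}.ncard ≤ d) :
    (chains α E).ncard ≤ d * (chains (fun j => α j.castSucc) E).ncard := by
  classical
  rw [Set.ncard_eq_toFinset_card _ (chains_finite α E),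
    Set.ncard_eq_toFinset_card _ (chains_finite (fun j => α j.castSucc) E)]
  refine (card_le_mul_card_image_of_maps_to (f := fun R i => R (Fin.castSucc i))
    (t := (chains_finite (fun j => α j.castSucc) E).toFinset) ?_ d ?_)
  · intro R hR
    simp only [Set.Finite.mem_toFinset] at hR ⊢
    exact ⟨fun i => hR.1 _, fun j => hR.2 j.castSucc⟩
  · intro R' hR'
    rw [Set.Finite.mem_toFinset] at hR'
    refine le_trans ?_ (hd (R' (Fin.last k)) (hR'.1 _) (Fin.last k))
    rw [← Set.ncard_coe_finset]
    refine Set.ncard_le_ncard_of_injOn (fun R => R (Fin.last (k + 1))) ?_ ?_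
      (E.finite_toSet.subset fun _ h => h.1)
    · intro R hR
      simp only [coe_filter, Set.Finite.mem_toFinset, Set.mem_ofPred_eq] at hR
      refine ⟨hR.1.1 _, ?_⟩
      have := hR.1.2 (Fin.last k)
      rw [← hR.2]
      simpa using this
    · intro R hR S hS hRS
      simp only [coe_filter, Set.Finite.mem_toFinset, Set.mem_ofPred_eq] at hR hS
      funext i
      induction i using Fin.lastCases with
      | last => exact hRS
      | cast i => exact congrFun (hR.2.trans hS.2.symm) i

open Finset in
/-- A chain is determined by its last edge and the chain without its last two points. -/
theorem ncard_chains_succ_succ_le {k : ℕ} (α : Fin (k + 2) → ℝ) (E : Finset Plane) (e : ℕ)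
    (he : ∀ j, {p : Plane × Plane | p.1 ∈ E ∧ p.2 ∈ E ∧ inner ℝ p.1 p.2 = α j}.ncard ≤ e) :
    (chains α E).ncard ≤ e * (chains (fun j => α j.castSucc.castSucc) E).ncard := by
  classical
  rw [Set.ncard_eq_toFinset_card _ (chains_finite α E),
    Set.ncard_eq_toFinset_card _ (chains_finite (fun j => α j.castSucc.castSucc) E)]
  refine (card_le_mul_card_image_of_maps_to (f := fun R i => R (Fin.castSucc (Fin.castSucc i)))
    (t := (chains_finite (fun j => α j.castSucc.castSucc) E).toFinset) ?_ e ?_)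
  · intro R hR
    simp only [Set.Finite.mem_toFinset] at hR ⊢
    exact ⟨fun i => hR.1 _, fun j => hR.2 j.castSucc.castSucc⟩
  · intro R' hR'
    refine le_trans ?_ (he (Fin.last (k + 1)))
    rw [← Set.ncard_coe_finset]
    refine Set.ncard_le_ncard_of_injOn
      (fun R => (R (Fin.last (k + 1)).castSucc, R (Fin.last (k + 2)))) ?_ ?_
      ((E ×ˢ E).finite_toSet.subset fun _ h => mem_product.2 ⟨h.1, h.2.1⟩)
    · intro R hR
      simp only [coe_filter, Set.Finite.mem_toFinset, Set.mem_ofPred_eq] at hR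
      exact ⟨hR.1.1 _, hR.1.1 _, hR.1.2 (Fin.last (k + 1))⟩
    · intro R hR S hS hRS
      simp only [coe_filter, Set.Finite.mem_toFinset, Set.mem_ofPred_eq] at hR hS
      rw [Prod.mk.injEq] at hRS
      funext i
      induction i using Fin.lastCases with
      | last => exact hRS.2
      | cast i =>
        induction i using Fin.lastCases with
        | last => exact hRS.1
        | cast i => exact congrFun (hR.2.trans hS.2.symm) i

/-! ### Edges and degrees -/

theorem plane_inner_eq (P Q : Plane) : inner ℝ P Q = P 0 * Q 0 + P 1 * Q 1 := by
  simp [PiLp.inner_apply, Fin.sum_univ_two, mul_comm]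

open Finset in
/-- The Szemerédi–Trotter bound for the number of pairs with a given nonzero dot product. -/
theorem ncard_edges_le {a : ℝ} (ha : a ≠ 0) (E : Finset Plane) (r : ℕ) (hr : 0 < r)
    (hE : #E ≤ r ^ 3) :
    {p : Plane × Plane | p.1 ∈ E ∧ p.2 ∈ E ∧ inner ℝ p.1 p.2 = a}.ncard ≤ 24 * r ^ 4 := by
  classical
  set T := (E ×ˢ E).filter fun p => inner ℝ p.1 p.2 = a with hT
  have hset : {p : Plane × Plane | p.1 ∈ E ∧ p.2 ∈ E ∧ inner ℝ p.1 p.2 = a} = (T : Set _) := by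
    ext p
    simp [hT, and_assoc]
  rw [hset, Set.ncard_coe_finset, ← card_filter_add_card_filter_not (fun p => p.1 1 = 0)]
  -- Here `P 1 = 0` gives a vertical line, and `P 0 * Q 0 = a ≠ 0` makes `Q` determine `P`.
  have hvert : #(T.filter fun p => p.1 1 = 0) ≤ r ^ 3 := by
    refine le_trans (card_le_card_of_injOn Prod.snd (t := E) ?_ ?_) hE
    · intro p hp
      have h1 := (mem_filter.1 (mem_filter.1 hp).1).1
      exact (mem_product.1 h1).2
    · intro p hp p' hp' h
      simp only [hT, coe_filter, Set.mem_ofPred_eq, mem_filter, plane_inner_eq] at hp hp'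
      have h1 := hp.1.2
      have h2 := hp'.1.2
      rw [hp.2, zero_mul, add_zero] at h1
      rw [hp'.2, zero_mul, add_zero, ← h] at h2
      have h3 : p.2 0 ≠ 0 := by
        rintro h0
        rw [h0, mul_zero] at h1
        exact ha h1.symm
      refine Prod.ext ?_ h
      ext i
      fin_cases i
      · exact mul_right_cancel₀ h3 (h1.trans h2.symm)
      · exact hp.2.trans hp'.2.symm
  let pt : Plane → ℝ × ℝ := fun Q => (Q 0, Q 1)
  -- The line `P · Q = a` solved for `Q 1`; it determines `P` because `a ≠ 0`.
  let ln : Plane → ℝ × ℝ := fun P => (-(P 0 / P 1), a / P 1)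
  have hpt : Function.Injective pt := by
    intro P Q h
    rw [Prod.mk.injEq] at h
    ext i
    fin_cases i
    exacts [h.1, h.2]
  have hln : ∀ P Q : Plane, P 1 ≠ 0 → Q 1 ≠ 0 → ln P = ln Q → P = Q := by
    intro P Q hP hQ h
    rw [Prod.mk.injEq, div_eq_div_iff hP hQ, neg_inj, div_eq_div_iff hP hQ] at h
    have h1 : Q 1 = P 1 := mul_left_cancel₀ ha h.2
    have h0 := h.1
    rw [h1] at h0
    ext i
    fin_cases i
    exacts [mul_right_cancel₀ hP h0, h1.symm]
  have hrest : #(T.filter fun p => ¬ p.1 1 = 0) ≤ 23 * r ^ 4 := by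
    refine le_trans ?_ (Incidence.sum_card_through_le_pow_four (E.image pt) (E.image ln) r hr
      (card_image_le.trans hE) (card_image_le.trans hE))
    rw [← card_sigma]
    refine card_le_card_of_injOn (fun p => ⟨pt p.2, ln p.1⟩) ?_ ?_
    · intro p hp
      simp only [hT, coe_filter, Set.mem_ofPred_eq, mem_filter, mem_product, plane_inner_eq] at hp
      have hp0 := hp.2
      rw [mem_coe, mem_sigma, Incidence.mem_through]
      refine ⟨mem_image_of_mem _ hp.1.1.2, mem_image_of_mem _ hp.1.1.1, ?_⟩
      simp only [pt, ln, Incidence.lineEval]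
      field_simp
      linarith [hp.1.2]
    · intro p hp p' hp' h
      simp only [hT, coe_filter, Set.mem_ofPred_eq, mem_filter] at hp hp'
      simp only [Sigma.mk.injEq, heq_eq_eq] at h
      exact Prod.ext (hln _ _ hp.2 hp'.2 h.2) (hpt h.1)
  have h3 : r ^ 3 ≤ r ^ 4 := Nat.pow_le_pow_right hr (by norm_num)
  omega

open Finset in
/-- A line contains few points of a separated subset of the unit square. -/
theorem ncard_neighbors_le {a δ : ℝ} (ha : a ≠ 0) (hδ : 0 < δ) (E : Finset Plane)
    (hE : ∀ Q ∈ E, ∀ i, Q i ∈ Set.Icc (0 : ℝ) 1)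
    (hsep : ∀ Q ∈ E, ∀ Q' ∈ E, Q ≠ Q' → δ ≤ dist Q Q') (P : Plane) :
    {Q | Q ∈ E ∧ inner ℝ P Q = a}.ncard ≤ ⌊2 / δ⌋₊ + 1 := by
  -- The line varies at least as much in coordinate `j` as in coordinate `i`. Two points in the same
  -- bin of width `δ / 2` in coordinate `j` are therefore closer than `δ`.
  obtain ⟨i, j, hsum, hle⟩ : ∃ i j : Fin 2, (∀ f : Fin 2 → ℝ, f 0 + f 1 = f i + f j) ∧
      |P j| ≤ |P i| := by
    rcases le_total |P 1| |P 0| with h | h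
    · exact ⟨0, 1, fun f => rfl, h⟩
    · exact ⟨1, 0, fun f => add_comm _ _, h⟩
  rw [← card_range (⌊2 / δ⌋₊ + 1), ← Set.ncard_coe_finset]
  refine Set.ncard_le_ncard_of_injOn (fun Q => ⌊2 * Q j / δ⌋₊) ?_ ?_ (finite_toSet _)
  · rintro Q ⟨hQ, -⟩
    rw [mem_coe, mem_range, Nat.lt_succ_iff]
    refine Nat.floor_le_floor ?_
    have := (hE Q hQ j).2
    gcongr
    linarith
  · rintro Q ⟨hQ, hPQ⟩ Q' ⟨hQ', hPQ'⟩ hfl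
    simp only at hfl
    by_contra hne
    have hd := hsep Q hQ Q' hQ' hne
    rw [plane_inner_eq, hsum (fun i => P i * Q i)] at hPQ
    rw [plane_inner_eq, hsum (fun i => P i * Q' i)] at hPQ'
    have hPi : P i ≠ 0 := by
      intro h0
      have h1 : P j = 0 := by
        rw [h0, abs_zero] at hle
        exact abs_nonpos_iff.1 hle
      rw [h0, h1] at hPQ
      exact ha (by linarith)
    have h1 : |Q i - Q' i| ≤ |Q j - Q' j| := by
      have h2 : P i * (Q i - Q' i) = -(P j * (Q j - Q' j)) := by linarith
      have h3 : |P i| * |Q i - Q' i| = |P j| * |Q j - Q' j| := by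
        rw [← abs_mul, h2, abs_neg, abs_mul]
      have h4 : |P i| * |Q i - Q' i| ≤ |P i| * |Q j - Q' j| := by
        rw [h3]; gcongr
      exact le_of_mul_le_mul_left h4 (abs_pos.2 hPi)
    have h5 : |Q j - Q' j| < δ / 2 := by
      have hfl' := Nat.floor_le (show 0 ≤ 2 * Q j / δ from
        div_nonneg (mul_nonneg zero_le_two (hE Q hQ j).1) hδ.le)
      have hfl'' := Nat.floor_le (show 0 ≤ 2 * Q' j / δ from
        div_nonneg (mul_nonneg zero_le_two (hE Q' hQ' j).1) hδ.le)
      have hlt := Nat.lt_floor_add_one (2 * Q j / δ)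
      have hlt' := Nat.lt_floor_add_one (2 * Q' j / δ)
      rw [← hfl] at hfl'' hlt'
      rw [le_div_iff₀ hδ] at hfl' hfl''
      rw [div_lt_iff₀ hδ] at hlt hlt'
      rw [abs_lt]
      constructor <;> linarith
    have h6 : dist Q Q' ^ 2 = (Q i - Q' i) ^ 2 + (Q j - Q' j) ^ 2 := by
      rw [EuclideanSpace.dist_eq, Real.sq_sqrt (by positivity), Fin.sum_univ_two,
        hsum (fun i => dist (Q i) (Q' i) ^ 2), Real.dist_eq, Real.dist_eq, sq_abs, sq_abs]
    have h7 : (Q i - Q' i) ^ 2 ≤ (Q j - Q' j) ^ 2 := sq_le_sq.2 h1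
    have h8 : (Q j - Q' j) ^ 2 < (δ / 2) ^ 2 := by
      rw [← sq_abs]
      gcongr
    have h9 : δ ^ 2 ≤ dist Q Q' ^ 2 := by gcongr
    nlinarith

/-! ### Assembling the bounds -/

/-- The bounds on chains of length `3 * m + 1`, `3 * m + 2` and `3 * m + 3` in terms of bounds on
edges and degrees. -/
theorem ncard_chains_le_of_bounds (E : Finset Plane) (e d : ℕ)
    (he : ∀ a : ℝ, a ≠ 0 →
      {p : Plane × Plane | p.1 ∈ E ∧ p.2 ∈ E ∧ inner ℝ p.1 p.2 = a}.ncard ≤ e)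
    (hd : ∀ a : ℝ, a ≠ 0 → ∀ P ∈ E, {Q | Q ∈ E ∧ inner ℝ P Q = a}.ncard ≤ d) (m : ℕ) :
    (∀ α : Fin (3 * m + 1) → ℝ, (∀ j, α j ≠ 0) →
      (chains α E).ncard ≤ e ^ (m + 1) * d ^ m) ∧
    (∀ α : Fin (3 * m + 2) → ℝ, (∀ j, α j ≠ 0) →
      (chains α E).ncard ≤ e ^ (m + 1) * d ^ (m + 1)) ∧
    (∀ α : Fin (3 * m + 3) → ℝ, (∀ j, α j ≠ 0) →
      (chains α E).ncard ≤ e ^ (m + 2) * d ^ m) := by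
  have hd' : ∀ {k : ℕ} (α : Fin (k + 1) → ℝ), (∀ j, α j ≠ 0) →
      (chains α E).ncard ≤ d * (chains (fun j => α j.castSucc) E).ncard := fun α hα =>
    ncard_chains_succ_le α E d fun P hP j => hd _ (hα j) P hP
  have he' : ∀ {k : ℕ} (α : Fin (k + 2) → ℝ), (∀ j, α j ≠ 0) →
      (chains α E).ncard ≤ e * (chains (fun j => α j.castSucc.castSucc) E).ncard := fun α hα =>
    ncard_chains_succ_succ_le α E e fun j => he _ (hα j)
  have key : ∀ m : ℕ, (∀ α : Fin (3 * m + 1) → ℝ, (∀ j, α j ≠ 0) →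
        (chains α E).ncard ≤ e ^ (m + 1) * d ^ m) →
      (∀ α : Fin (3 * m + 2) → ℝ, (∀ j, α j ≠ 0) →
        (chains α E).ncard ≤ e ^ (m + 1) * d ^ (m + 1)) ∧
      (∀ α : Fin (3 * m + 3) → ℝ, (∀ j, α j ≠ 0) →
        (chains α E).ncard ≤ e ^ (m + 2) * d ^ m) := by
    intro m h
    constructor
    · intro α hα
      calc _ ≤ _ := hd' α hα
        _ ≤ d * (e ^ (m + 1) * d ^ m) := Nat.mul_le_mul_left _ (h _ fun j => hα _)
        _ = _ := by ring
    · intro α hα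
      calc _ ≤ _ := he' α hα
        _ ≤ e * (e ^ (m + 1) * d ^ m) := Nat.mul_le_mul_left _ (h _ fun j => hα _)
        _ = _ := by ring
  have base : ∀ α : Fin (3 * m + 1) → ℝ, (∀ j, α j ≠ 0) →
      (chains α E).ncard ≤ e ^ (m + 1) * d ^ m := by
    induction m with
    | zero =>
      intro α hα
      rw [zero_add, pow_one, pow_zero, mul_one]
      refine le_trans (Set.ncard_le_ncard_of_injOn (fun R => (R 0, R 1)) ?_ ?_
        ((E ×ˢ E).finite_toSet.subset fun _ h => Finset.mem_product.2 ⟨h.1, h.2.1⟩))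
        (he (α 0) (hα 0))
      · exact fun R hR => ⟨hR.1 _, hR.1 _, hR.2 0⟩
      · intro R _ S _ hRS
        rw [Prod.mk.injEq] at hRS
        funext i
        fin_cases i
        exacts [hRS.1, hRS.2]
    | succ m ih =>
      intro α hα
      -- Drop an edge to reach length `3 * m + 2`, then a point to reach `3 * m + 1`.
      calc (chains α E).ncard ≤ _ := he' (k := 3 * m + 2) α hα
        _ ≤ e * (e ^ (m + 1) * d ^ (m + 1)) :=
            Nat.mul_le_mul_left _ ((key m ih).1 _ fun j => hα _)
        _ = _ := by ring
  exact ⟨base, key m base⟩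

/-- Bounds on edges and degrees in an adaptable set. -/
theorem IsAdaptable.exists_bounds {s A : ℝ} {E : Finset Plane} (h : IsAdaptable s A E)
    (hs : 0 < s) (hn : 1 ≤ E.card) : ∃ e d : ℕ,
      (∀ a : ℝ, a ≠ 0 →
        {p : Plane × Plane | p.1 ∈ E ∧ p.2 ∈ E ∧ inner ℝ p.1 p.2 = a}.ncard ≤ e) ∧
      (∀ a : ℝ, a ≠ 0 → ∀ P ∈ E, {Q | Q ∈ E ∧ inner ℝ P Q = a}.ncard ≤ d) ∧
      (e : ℝ) ≤ 384 * (E.card : ℝ) ^ ((4 : ℝ) / 3) ∧ (d : ℝ) ≤ 384 * (E.card : ℝ) ^ (1 / s) := by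
  set n : ℝ := ((E.card : ℕ) : ℝ) with hndef
  have hn1 : (1 : ℝ) ≤ n := by rw [hndef]; exact_mod_cast hn
  have hn0 : 0 < n := by linarith
  set r := ⌈n ^ ((1 : ℝ) / 3)⌉₊ with hr
  have hc1 : 1 ≤ n ^ ((1 : ℝ) / 3) := Real.one_le_rpow hn1 (by norm_num)
  have hr1 : n ^ ((1 : ℝ) / 3) ≤ r := Nat.le_ceil _
  have hr2 : (r : ℝ) ≤ 2 * n ^ ((1 : ℝ) / 3) := by
    have := (Nat.ceil_lt_add_one (zero_le_one.trans hc1)).le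
    linarith
  have hr0 : 0 < r := Nat.ceil_pos.2 (by linarith)
  have hcard : E.card ≤ r ^ 3 := by
    have h1 : n ≤ (r : ℝ) ^ 3 := by
      calc n = (n ^ ((1 : ℝ) / 3)) ^ 3 := by
            rw [← Real.rpow_natCast, ← Real.rpow_mul hn0.le]; norm_num
        _ ≤ _ := by gcongr
    rw [hndef] at h1
    exact_mod_cast h1
  have hδ : 0 < n ^ (-(1 / s)) := Real.rpow_pos_of_pos hn0 _
  -- Since `r ≤ 2 * n ^ (1 / 3)`, the edge constant is `24 * 2 ^ 4 = 384`. The degree constant would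
  -- be 3; one common constant is kept.
  refine ⟨24 * r ^ 4, ⌊2 / n ^ (-(1 / s))⌋₊ + 1, fun a ha => ncard_edges_le ha E r hr0 hcard,
    fun a ha P _ => ncard_neighbors_le ha hδ E h.subset_square h.separation P, ?_, ?_⟩
  · push_cast
    calc (24 : ℝ) * r ^ 4 ≤ 24 * (2 * n ^ ((1 : ℝ) / 3)) ^ 4 := by gcongr
      _ = 384 * (n ^ ((1 : ℝ) / 3)) ^ 4 := by ring
      _ = _ := by
          rw [← Real.rpow_natCast (n ^ ((1 : ℝ) / 3)), ← Real.rpow_mul hn0.le]; norm_num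
  · push_cast
    have h1 : 2 / n ^ (-(1 / s)) = 2 * n ^ (1 / s) := by
      rw [Real.rpow_neg hn0.le, div_inv_eq_mul]
    have h2 : 1 ≤ n ^ (1 / s) := Real.one_le_rpow hn1 (by positivity)
    have h3 := Nat.floor_le (a := 2 / n ^ (-(1 / s))) (by positivity)
    linarith

/-- Bounds in terms of the number of edges and of the maximal degree, as powers of `n`. -/
theorem pow_mul_pow_le_rpow {e d : ℕ} {n x y : ℝ} (hn : 1 ≤ n)
    (he : (e : ℝ) ≤ 384 * n ^ x) (hd : (d : ℝ) ≤ 384 * n ^ y) (a b : ℕ) {l u w : ℝ}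
    (hl : 1 ≤ l) (hu : 0 ≤ u) (hw : x * a + y * b = w) :
    (e : ℝ) ^ a * (d : ℝ) ^ b ≤ 384 ^ (a + b) * (l ^ u * n ^ w) := by
  have hn0 : 0 < n := by linarith
  calc (e : ℝ) ^ a * (d : ℝ) ^ b ≤ (384 * n ^ x) ^ a * (384 * n ^ y) ^ b := by gcongr
    _ = 384 ^ (a + b) * n ^ w := by
        rw [← hw, Real.rpow_add hn0, Real.rpow_mul hn0.le, Real.rpow_mul hn0.le,
          Real.rpow_natCast, Real.rpow_natCast, mul_pow, mul_pow, pow_add]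
        ring
    _ ≤ 384 ^ (a + b) * (l ^ u * n ^ w) := by
        gcongr
        exact le_mul_of_one_le_left (Real.rpow_nonneg hn0.le _) (Real.one_le_rpow hl hu)

theorem mainTheorem6 (k : ℕ) (hk : 1 ≤ k) (A : ℝ) :
    ∃ (C : ℝ) (N : ℕ), ∀ (s : ℝ), 0 < s → s ≤ 2 →
      ∀ (α : Fin k → ℝ), (∀ j, α j ≠ 0) →
      ∀ (E : Finset Plane), N < E.card → IsAdaptable s A E →
        ((chains α E).ncard : ℝ) ≤ C * chainBound k s E.card := by
  obtain ⟨m, hm⟩ : ∃ m, k = 3 * m + 1 ∨ k = 3 * m + 2 ∨ k = 3 * m + 3 :=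
    ⟨(k - 1) / 3, by omega⟩
  -- Taking `N = 1` forces `n ≥ 2`, so `logb 2 n ≥ 1` and its nonnegative powers can be inserted.
  have main : ∀ (s : ℝ), 0 < s → ∀ E : Finset Plane, 1 < E.card → IsAdaptable s A E →
      1 ≤ Real.logb 2 E.card ∧ (1 : ℝ) ≤ E.card ∧ ∃ e d : ℕ,
        (e : ℝ) ≤ 384 * (E.card : ℝ) ^ ((4 : ℝ) / 3) ∧
        (d : ℝ) ≤ 384 * (E.card : ℝ) ^ (1 / s) ∧ _ := fun s hs E hE h => by
    obtain ⟨e, d, he, hd, he', hd'⟩ := h.exists_bounds hs hE.le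
    have h2 : (2 : ℝ) ≤ E.card := by exact_mod_cast hE
    refine ⟨?_, by linarith, e, d, he', hd', ncard_chains_le_of_bounds E e d he hd m⟩
    rw [Real.le_logb_iff_rpow_le one_lt_two (by linarith), Real.rpow_one]
    exact h2
  rcases hm with rfl | rfl | rfl
  · refine ⟨384 ^ (m + 1 + m), 1, fun s hs _ α hα E hE h => ?_⟩
    obtain ⟨hl, hn, e, d, he, hd, hc, -, -⟩ := main s hs E hE h
    rw [chainBound, if_neg (by omega), if_pos (by omega)]
    calc _ ≤ ((e ^ (m + 1) * d ^ m : ℕ) : ℝ) := by exact_mod_cast hc α hα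
      _ = (e : ℝ) ^ (m + 1) * (d : ℝ) ^ m := by push_cast; rfl
      _ ≤ _ := pow_mul_pow_le_rpow hn he hd _ _ hl ?_ ?_
    · push_cast
      have : (0 : ℝ) ≤ m := m.cast_nonneg
      linarith
    · push_cast
      field_simp
      ring
  · refine ⟨384 ^ (m + 1 + (m + 1)), 1, fun s hs _ α hα E hE h => ?_⟩
    obtain ⟨hl, hn, e, d, he, hd, -, hc, -⟩ := main s hs E hE h
    rw [chainBound, if_neg (by omega), if_neg (by omega)]
    calc _ ≤ ((e ^ (m + 1) * d ^ (m + 1) : ℕ) : ℝ) := by exact_mod_cast hc α hα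
      _ = (e : ℝ) ^ (m + 1) * (d : ℝ) ^ (m + 1) := by push_cast; rfl
      _ ≤ _ := pow_mul_pow_le_rpow hn he hd _ _ hl ?_ ?_
    · push_cast
      have : (0 : ℝ) ≤ m := m.cast_nonneg
      linarith
    · push_cast
      field_simp
      ring
  · refine ⟨384 ^ (m + 2 + m), 1, fun s hs _ α hα E hE h => ?_⟩
    obtain ⟨hl, hn, e, d, he, hd, -, -, hc⟩ := main s hs E hE h
    rw [chainBound, if_pos (by omega)]
    calc _ ≤ ((e ^ (m + 2) * d ^ m : ℕ) : ℝ) := by exact_mod_cast hc α hα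
      _ = (e : ℝ) ^ (m + 2) * (d : ℝ) ^ m := by push_cast; rfl
      _ ≤ _ := pow_mul_pow_le_rpow hn he hd _ _ hl ?_ ?_
    · push_cast
      have : (0 : ℝ) ≤ m := m.cast_nonneg
      linarith
    · push_cast
      field_simp
      ring
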